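/- Let $\mathbb R^6_3$ be $\mathbb R^6$ with $\langle u,v\rangle=-\sum_{i\le 3}u_iv_i+\sum_{i\ge 4}u_iv_i$, and let $S^5_3=\{x\in\mathbb R^6_3 : \langle x,x\rangle=1\}$. Let $M$ be a connected non-degenerate smooth hypersurface (possibly immersed) of dimension $4$ in $S^5_3$ with a smooth unit normal vector field $\xi$ ($\langle\xi,\xi\rangle=\pm1$), and let $A X=-\bar\nabla_X\xi$ be its shape operator, where $\bar\nabla$ is the Levi-Civita connection of $S^5_3$. The principal curvatures of $M$ are the real and complex eigenvalues of $A$ (counted with algebraic multiplicity). Suppose that $M$ is isoparametric, i.e. its principal curvatures are constant on $M$, and that $M$ is of Petrov type II of index $2$, i.e. at each $x\in M$ there are a basis of $T_xM$ and real numbers $\alpha_1,\alpha_2$ and $\beta_1,\beta_2>0$ such that the matrices of $A_x$ and of the induced metric in this basis are $$A_x\sim\begin{pmatrix}\alpha_1&-\beta_1&0&0\\ \beta_1&\alpha_1&0&0\\ 0&0&\alpha_2&-\beta_2\\ 0&0&\beta_2&\alpha_2\end{pmatrix},\qquad \langle\cdot,\cdot\rangle_x\sim\begin{pmatrix}-1&0&0&0\\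 0&1&0&0\\ 0&0&-1&0\\ 0&0&0&1\end{pmatrix}.$$ If every complex (non-real) principal curvature of $M$ has multiplicity $2$, then every complex principal curvature $\lambda$ of $M$ satisfies $|\lambda|=1$. -/

import Mathlib

open scoped Manifold ContDiff

noncomputable section

namespace PseudoSphere

/-- The underlying vector space of the pseudo-Euclidean space `ℝ^m_s`. -/
abbrev Coord (m : ℕ) : Type := EuclideanSpace ℝ (Fin m)

/-- The pseudo-inner product `⟨u, v⟩_s = - ∑_{i < s} u_i v_i + ∑_{i ≥ s} u_i v_i` of `ℝ^m_s`. -/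
def pseudoInner (m s : ℕ) : LinearMap.BilinForm ℝ (Coord m) :=
  LinearMap.mk₂ ℝ (fun u v => ∑ i : Fin m, (if (i : ℕ) < s then (-1 : ℝ) else 1) * (u i * v i))
    (fun u u' v => by
      rw [← Finset.sum_add_distrib]
      exact Finset.sum_congr rfl fun i _ => by simp only [PiLp.add_apply]; ring)
    (fun c u v => by
      rw [smul_eq_mul, Finset.mul_sum]
      exact Finset.sum_congr rfl fun i _ => by simp only [PiLp.smul_apply, smul_eq_mul]; ring)
    (fun u v v' => by
      rw [← Finset.sum_add_distrib]
      exact Finset.sum_congr rfl fun i _ => by simp only [PiLp.add_apply]; ring)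
    (fun c u v => by
      rw [smul_eq_mul, Finset.mul_sum]
      exact Finset.sum_congr rfl fun i _ => by simp only [PiLp.smul_apply, smul_eq_mul]; ring)

theorem pseudoInner_apply (m s : ℕ) (u v : Coord m) :
    pseudoInner m s u v = ∑ i : Fin m, (if (i : ℕ) < s then (-1 : ℝ) else 1) * (u i * v i) := rfl

theorem pseudoInner_comm (m s : ℕ) (u v : Coord m) :
    pseudoInner m s u v = pseudoInner m s v u := by
  simp only [pseudoInner_apply, mul_comm (u _)]

theorem pseudoInner_nondegenerate (m s : ℕ) : (pseudoInner m s).Nondegenerate := by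
  have key : ∀ u : Coord m, (∀ v, pseudoInner m s u v = 0) → u = 0 := by
    intro u hu
    ext j
    have h := hu (EuclideanSpace.single j 1)
    rw [pseudoInner_apply, Finset.sum_eq_single j] at h
    · by_cases hj : (j : ℕ) < s <;> simpa [hj] using h
    · intro i _ hij
      simp [hij]
    · simp
  exact ⟨key, fun u hu => key u fun v => by rw [pseudoInner_comm]; exact hu v⟩

/-- The pseudo-sphere `S^n_s = {x ∈ ℝ^{n+1}_s | ⟨x, x⟩_s = 1}`; for `s = n` (when that set has two
components) only the part with positive last coordinate is taken. -/
def pseudoSphere (n s : ℕ) : Set (Coord (n + 1)) :=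
  {p | pseudoInner (n + 1) s p p = 1 ∧ (s = n → 0 < p (Fin.last n))}

/-- An `n`-dimensional non-degenerate immersed hypersurface of `S^{n+1}_s ⊆ ℝ^{n+2}_s` with a
smooth unit normal vector field. An embedded hypersurface is the case where `toFun` is the
inclusion. Non-degeneracy of the induced metric is equivalent to the existence of a unit normal
vector at each point, so it is not listed separately. -/
structure Hypersurface (n s : ℕ) (M : Type*) [TopologicalSpace M]
    [ChartedSpace (EuclideanSpace ℝ (Fin n)) M] where
  /-- the immersion (for a subset `M` of the pseudo-sphere: the inclusion) -/
  toFun : M → Coord (n + 1 + 1)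
  smooth : ContMDiff (𝓡 n) 𝓘(ℝ, Coord (n + 1 + 1)) ∞ toFun
  mem_pseudoSphere : ∀ x, toFun x ∈ pseudoSphere (n + 1) s
  immersion : ∀ x, Function.Injective (mfderiv (𝓡 n) 𝓘(ℝ, Coord (n + 1 + 1)) toFun x)
  /-- the unit normal vector field `ξ` -/
  normal : M → Coord (n + 1 + 1)
  normal_smooth : ContMDiff (𝓡 n) 𝓘(ℝ, Coord (n + 1 + 1)) ∞ normal
  /-- `ξ` is tangent to the pseudo-sphere -/
  normal_tangent : ∀ x, pseudoInner (n + 1 + 1) s (normal x) (toFun x) = 0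
  /-- `ξ` is normal to the hypersurface -/
  normal_orthogonal : ∀ (x : M) (v : TangentSpace (𝓡 n) x), pseudoInner (n + 1 + 1) s (normal x)
    (mfderiv (𝓡 n) 𝓘(ℝ, Coord (n + 1 + 1)) toFun x v) = 0
  /-- `ξ` is a unit field, spacelike or timelike -/
  normal_unit : ∀ x, pseudoInner (n + 1 + 1) s (normal x) (normal x) = 1 ∨
    pseudoInner (n + 1 + 1) s (normal x) (normal x) = -1

namespace Hypersurface

variable {n s : ℕ} {M : Type*} [TopologicalSpace M] [ChartedSpace (EuclideanSpace ℝ (Fin n)) M]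

instance tangentSpace_finite (x : M) : Module.Finite ℝ (TangentSpace (𝓡 n) x) :=
  inferInstanceAs (Module.Finite ℝ (EuclideanSpace ℝ (Fin n)))

/-- The differential `T_x M → ℝ^{n+2}_s` of the immersion. -/
def tangentMap (F : Hypersurface n s M) (x : M) :
    TangentSpace (𝓡 n) x →ₗ[ℝ] Coord (n + 1 + 1) :=
  (mfderiv (𝓡 n) 𝓘(ℝ, Coord (n + 1 + 1)) F.toFun x).toLinearMap

/-- The induced metric on `T_x M`. -/
def metric (F : Hypersurface n s M) (x : M) : LinearMap.BilinForm ℝ (TangentSpace (𝓡 n) x) :=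
  (pseudoInner (n + 1 + 1) s).compl₁₂ (F.tangentMap x) (F.tangentMap x)

/-- The flat derivative `D_X ξ` in `ℝ^{n+2}_s` of the unit normal field. -/
def flatDerivNormal (F : Hypersurface n s M) (x : M) :
    TangentSpace (𝓡 n) x →ₗ[ℝ] Coord (n + 1 + 1) :=
  (mfderiv (𝓡 n) 𝓘(ℝ, Coord (n + 1 + 1)) F.normal x).toLinearMap

/-- The covariant derivative of `ξ` along the immersion for the Levi-Civita connection of the
pseudo-sphere, which is the tangential part `D_X ξ - ⟨D_X ξ, p⟩ p` of the flat derivative,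
`p` being the base point. -/
def covDerivNormal (F : Hypersurface n s M) (x : M) :
    TangentSpace (𝓡 n) x →ₗ[ℝ] Coord (n + 1 + 1) :=
  F.flatDerivNormal x -
    (((pseudoInner (n + 1 + 1) s).flip (F.toFun x)).comp (F.flatDerivNormal x)).smulRight
      (F.toFun x)

theorem covDerivNormal_apply (F : Hypersurface n s M) (x : M) (v : TangentSpace (𝓡 n) x) :
    F.covDerivNormal x v = F.flatDerivNormal x v -
      pseudoInner (n + 1 + 1) s (F.flatDerivNormal x v) (F.toFun x) • F.toFun x := rfl

theorem pseudoInner_toFun (F : Hypersurface n s M) (x : M) :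
    pseudoInner (n + 1 + 1) s (F.toFun x) (F.toFun x) = 1 := (F.mem_pseudoSphere x).1

/-- If `⟨g, g⟩` is locally constant, then `⟨dg(v), g⟩ = 0`. -/
theorem pseudoInner_mfderiv_self {m t : ℕ} (g : M → Coord m)
    (hg : ContMDiff (𝓡 n) 𝓘(ℝ, Coord m) ∞ g)
    (x : M) (c : ℝ) (hc : ∀ᶠ y in nhds x, pseudoInner m t (g y) (g y) = c)
    (v : TangentSpace (𝓡 n) x) :
    pseudoInner m t (mfderiv (𝓡 n) 𝓘(ℝ, Coord m) g x v) (g x) = 0 := by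
  have hgx : MDifferentiableAt (𝓡 n) 𝓘(ℝ, Coord m) g x := (hg x).mdifferentiableAt (by simp)
  let L : Coord m →L[ℝ] Coord m →L[ℝ] ℝ :=
    LinearMap.toContinuousLinearMap
      ((LinearMap.toContinuousLinearMap (𝕜 := ℝ) (E := Coord m) (F' := ℝ)).toLinearMap ∘ₗ
        pseudoInner m t)
  have hL : ∀ u w, L u w = pseudoInner m t u w := fun _ _ => rfl
  have hq := L.hasFDerivAt_of_bilinear (hasFDerivAt_id (g x)) (hasFDerivAt_id (g x))
  have hcomp := hq.hasMFDerivAt.comp x hgx.hasMFDerivAt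
  have hconst : HasMFDerivAt (𝓡 n) 𝓘(ℝ, ℝ) (fun _ : M => c) x
      (0 : TangentSpace (𝓡 n) x →L[ℝ] TangentSpace 𝓘(ℝ, ℝ) c) := hasMFDerivAt_const c x
  have heq := hconst.congr_of_eventuallyEq
    (f₁ := (fun y => L (id y) (id y)) ∘ g) (hc.mono fun y hy => hy)
  have h := congrArg (fun T => T v) (hasMFDerivAt_unique hcomp heq)
  have key : ∀ w : Coord m, L (g x) w + L w (g x) = 0 → pseudoInner m t w (g x) = 0 := by
    intro w hw
    rw [hL, hL, pseudoInner_comm] at hw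
    linarith
  exact key _ h

theorem normal_ne_zero_sq (F : Hypersurface n s M) (x : M) :
    pseudoInner (n + 1 + 1) s (F.normal x) (F.normal x) ≠ 0 := by
  rcases F.normal_unit x with h | h <;> rw [h] <;> norm_num

/-- The tangent space is the whole orthogonal complement of the position vector and the normal. -/
theorem tangentMap_range (F : Hypersurface n s M) (x : M) (w : Coord (n + 1 + 1))
    (h₁ : pseudoInner (n + 1 + 1) s w (F.toFun x) = 0)
    (h₂ : pseudoInner (n + 1 + 1) s w (F.normal x) = 0) :
    w ∈ LinearMap.range (F.tangentMap x) := by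
  set B := pseudoInner (n + 1 + 1) s with hB
  let e : Fin 2 → Coord (n + 1 + 1) := ![F.toFun x, F.normal x]
  let W : Submodule ℝ (Coord (n + 1 + 1)) := Submodule.span ℝ (Set.range e)
  have hmem : ∀ u : Coord (n + 1 + 1), B u (F.toFun x) = 0 → B u (F.normal x) = 0 →
      u ∈ LinearMap.BilinForm.orthogonal B W := by
    intro u hp hn
    rw [LinearMap.BilinForm.mem_orthogonal_iff]
    intro z hz
    have hz' : W ≤ LinearMap.ker (B u) := by
      refine Submodule.span_le.2 ?_
      rintro _ ⟨i, rfl⟩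
      fin_cases i
      · exact hp
      · exact hn
    change B z u = 0
    rw [hB, pseudoInner_comm]
    exact hz' hz
  have hli : LinearIndependent ℝ e := by
    rw [LinearIndependent.pair_iff]
    intro a b hab
    have ha : a = 0 := by
      have := congrArg (fun z => B z (F.toFun x)) hab
      simpa [hB, F.pseudoInner_toFun, F.normal_tangent] using this
    refine ⟨ha, ?_⟩
    subst ha
    have := congrArg (fun z => B z (F.normal x)) hab
    simpa [hB, F.normal_ne_zero_sq] using this
  have hW : Module.finrank ℝ W = 2 := by
    rw [finrank_span_eq_card hli]; simp
  have hO := LinearMap.BilinForm.finrank_orthogonal (pseudoInner_nondegenerate (n + 1 + 1) s) W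
  have hR : Module.finrank ℝ (LinearMap.range (F.tangentMap x)) = n := by
    have hinj : Function.Injective (F.tangentMap x) := F.immersion x
    rw [LinearMap.finrank_range_of_inj hinj]
    exact finrank_euclideanSpace_fin
  have hle : LinearMap.range (F.tangentMap x) ≤ LinearMap.BilinForm.orthogonal B W := by
    rintro _ ⟨v, rfl⟩
    refine hmem _ ?_ ?_
    · exact pseudoInner_mfderiv_self F.toFun F.smooth x 1
        (Filter.Eventually.of_forall F.pseudoInner_toFun) v
    · rw [hB, pseudoInner_comm]
      exact F.normal_orthogonal x v
  have heq := Submodule.eq_of_le_of_finrank_eq hle (by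
    rw [hR, hO, hW, finrank_euclideanSpace_fin]; omega)
  rw [heq]
  exact hmem w h₁ h₂

theorem covDerivNormal_mem_range (F : Hypersurface n s M) (x : M) (v : TangentSpace (𝓡 n) x) :
    (-F.covDerivNormal x) v ∈ LinearMap.range (F.tangentMap x) := by
  rw [LinearMap.neg_apply]
  refine Submodule.neg_mem _ (F.tangentMap_range x _ ?_ ?_)
  · rw [covDerivNormal_apply, LinearMap.map_sub₂, LinearMap.map_smul₂, F.pseudoInner_toFun]
    simp
  · have hcont : Continuous fun y => pseudoInner (n + 1 + 1) s (F.normal y) (F.normal y) := by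
      have hn := F.normal_smooth.continuous
      simp only [pseudoInner_apply]
      fun_prop
    have hc : ∀ᶠ y in nhds x, pseudoInner (n + 1 + 1) s (F.normal y) (F.normal y) =
        pseudoInner (n + 1 + 1) s (F.normal x) (F.normal x) := by
      have h1 := Metric.tendsto_nhds.1 (hcont.continuousAt (x := x)) 1 one_pos
      filter_upwards [h1] with y hy
      rw [Real.dist_eq, abs_lt] at hy
      rcases F.normal_unit x with h | h <;> rcases F.normal_unit y with h' | h' <;>
        rw [h, h'] at hy <;> rw [h, h'] <;> norm_num at hy
    have h := pseudoInner_mfderiv_self F.normal F.normal_smooth x _ hc v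
    have ht : pseudoInner (n + 1 + 1) s (F.toFun x) (F.normal x) = 0 := by
      rw [pseudoInner_comm]; exact F.normal_tangent x
    rw [covDerivNormal_apply, LinearMap.map_sub₂, LinearMap.map_smul₂, ht, smul_zero, sub_zero]
    exact h

/-- The shape operator `A_x : T_x M → T_x M`, `A X = -∇̄_X ξ`, where `T_x M` is identified with its
image under the (injective) differential of the immersion. -/
def shapeOperator (F : Hypersurface n s M) (x : M) :
    Module.End ℝ (TangentSpace (𝓡 n) x) :=
  (LinearEquiv.ofInjective (F.tangentMap x) (F.immersion x)).symm.toLinearMap ∘ₗ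
    (-F.covDerivNormal x).codRestrict (LinearMap.range (F.tangentMap x))
      (F.covDerivNormal_mem_range x)

/-- The defining property `A X = -∇̄_X ξ` of the shape operator. -/
theorem tangentMap_shapeOperator (F : Hypersurface n s M) (x : M) (v : TangentSpace (𝓡 n) x) :
    F.tangentMap x (F.shapeOperator x v) = -F.covDerivNormal x v := by
  exact congrArg Subtype.val
    ((LinearEquiv.ofInjective (F.tangentMap x) (F.immersion x)).apply_symm_apply
      ((-F.covDerivNormal x).codRestrict (LinearMap.range (F.tangentMap x))
        (F.covDerivNormal_mem_range x) v))

/-- The principal curvatures at `x`: the real and complex eigenvalues of the shape operator,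
counted with algebraic multiplicity. -/
def principalCurvatures (F : Hypersurface n s M) (x : M) : Multiset ℂ :=
  ((F.shapeOperator x).charpoly.map (algebraMap ℝ ℂ)).roots

/-- All principal curvatures are constant. -/
def IsIsoparametric (F : Hypersurface n s M) : Prop :=
  ∀ x y : M, F.principalCurvatures x = F.principalCurvatures y

end Hypersurface

/-- The Petrov normal form of type II of index 2 (in dimension four) of a pair `(A, B)` of an
endomorphism and a symmetric bilinear form. The displayed matrix of `B` has index 2. -/
def IsPetrovTypeII {V : Type*} [AddCommGroup V] [Module ℝ V]
    (A : Module.End ℝ V) (B : LinearMap.BilinForm ℝ V) : Prop :=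
  ∃ (b : Module.Basis (Fin 4) ℝ V) (α₁ β₁ α₂ β₂ : ℝ), 0 < β₁ ∧ 0 < β₂ ∧
    LinearMap.toMatrix b b A =
      !![α₁, -β₁, 0, 0;
         β₁, α₁, 0, 0;
         0, 0, α₂, -β₂;
         0, 0, β₂, α₂] ∧
    LinearMap.BilinForm.toMatrix b B =
      !![-1, 0, 0, 0;
         0, 1, 0, 0;
         0, 0, -1, 0;
         0, 0, 0, 1]

/-- The Petrov type of a four-dimensional hypersurface is type II of index 2. -/
def Hypersurface.IsTypeII {s : ℕ} {M : Type*} [TopologicalSpace M]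
    [ChartedSpace (EuclideanSpace ℝ (Fin 4)) M] (F : Hypersurface 4 s M) : Prop :=
  ∀ x : M, IsPetrovTypeII (F.shapeOperator x) (F.metric x)

end PseudoSphere

end

/-! Write f for the position vector, ε = ⟨ξ, ξ⟩ and λ̄ for the conjugate of λ. A type II operator
has eigenvalues α₁ ± iβ₁ and α₂ ± iβ₂ with positive β's, so a non-real λ of multiplicity 2 forces
the two blocks to coincide, and (A - λ)(A - λ̄) = 0 (`IsPetrovTypeII.apply_apply`). Constancy of the
principal curvatures gives this at every point with the same λ. The rest is local and works in any
positive dimension.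

Extend the ambient form to a Hermitian form H on the complexification and put Φ = ξ + λ̄ f. Then dΦ
= -df ∘ (A - λ̄) takes values in the λ-eigenspace of A, which is isotropic for H and is its own
orthogonal complement among complex tangent vectors. Because λ is not real, S = D²Φ is orthogonal to
the image of dΦ (`secondDeriv_orthogonal`). One more derivative yields a Gauss-type symmetry of
H(S(X,Y), S(X',Z)) under exchange of X and X' (`secondDeriv_pairing_symm`).

The tangential part of S lies in the isotropic eigenspace and contributes nothing to this pairing.
The components along f and ξ give (1 + ε|λ|²) m(X,Y) conj(m(X',Z)), where m(X,Y) = H(dΦ Y, df X). If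
the factor were nonzero, the symmetry together with m(AX,Y) = λ m(X,Y) would force m = 0, against
non-degeneracy of the metric. Hence ε|λ|² = -1, so ε = -1 and |λ| = 1 (`norm_eq_one_of_local`). -/

noncomputable section

namespace PseudoSphere

open Filter Topology ComplexConjugate

/-! ### Differentiating pairings, and regularity of the shape operator -/

section Calculus

variable {E W : Type*} [NormedAddCommGroup E] [NormedSpace ℝ E]
  [NormedAddCommGroup W] [NormedSpace ℝ W]

/-- Differentiating a constant pairing. -/
theorem pairing_deriv_eq_zero (H : W →L[ℝ] W →L[ℝ] ℂ) {P Q : E → W} {P' Q' : E →L[ℝ] W} {u : E}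
    (hP : HasFDerivAt P P' u) (hQ : HasFDerivAt Q Q' u) {c : ℂ}
    (hc : ∀ᶠ y in 𝓝 u, H (P y) (Q y) = c) (v : E) :
    H (P' v) (Q u) + H (P u) (Q' v) = 0 := by
  have h1 := H.hasFDerivAt_of_bilinear hP hQ
  have h2 : HasFDerivAt (fun y => H (P y) (Q y)) (0 : E →L[ℝ] ℂ) u :=
    (hasFDerivAt_const c u).congr_of_eventuallyEq hc
  have h3 := congrArg (fun T : E →L[ℝ] ℂ => T v) (h1.unique h2)
  simpa [add_comm] using h3

theorem hasFDerivAt_fderiv_apply {f : E → W} {u : E} (hf : ContDiffAt ℝ 2 f u) (Y : E) :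
    HasFDerivAt (fun y => fderiv ℝ f y Y) ((fderiv ℝ (fderiv ℝ f) u).flip Y) u := by
  have h : DifferentiableAt ℝ (fderiv ℝ f) u :=
    (hf.fderiv_right (m := 1) (by norm_num)).differentiableAt (by simp)
  simpa using h.hasFDerivAt.clm_apply (hasFDerivAt_const Y u)

theorem fderiv_fderiv_comm {f : E → W} {u : E} (hf : ContDiffAt ℝ 2 f u) (X Y : E) :
    fderiv ℝ (fderiv ℝ f) u X Y = fderiv ℝ (fderiv ℝ f) u Y X :=
  hf.isSymmSndFDerivAt (by simp) X Y

/-- If `dp ∘ A = dq` with `dp` injective, then `A` is differentiable. -/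
theorem differentiableAt_of_fderiv_comp_eq [FiniteDimensional ℝ E] [FiniteDimensional ℝ W]
    {p q : E → W} {A : E → E →L[ℝ] E} {u : E} (hp : ContDiffAt ℝ 2 p u) (hq : ContDiffAt ℝ 2 q u)
    (hinj : Function.Injective (fderiv ℝ p u))
    (hA : ∀ᶠ y in 𝓝 u, ∀ v, fderiv ℝ p y (A y v) = fderiv ℝ q y v) :
    DifferentiableAt ℝ A u := by
  have : CompleteSpace E := FiniteDimensional.complete ℝ E
  -- With a fixed left inverse L of dp at u, the endomorphism L ∘ dp stays invertible near u, so A =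
  -- (L ∘ dp)⁻¹ (L ∘ dq) there.
  obtain ⟨l, hl⟩ := LinearMap.exists_leftInverse_of_injective (fderiv ℝ p u).toLinearMap
    (LinearMap.ker_eq_bot.2 hinj)
  set L : W →L[ℝ] E := LinearMap.toContinuousLinearMap l
  have hdp : DifferentiableAt ℝ (fderiv ℝ p) u :=
    (hp.fderiv_right (m := 1) (by norm_num)).differentiableAt (by simp)
  have hdq : DifferentiableAt ℝ (fderiv ℝ q) u :=
    (hq.fderiv_right (m := 1) (by norm_num)).differentiableAt (by simp)
  have hM : DifferentiableAt ℝ (fun y => L ∘L fderiv ℝ p y) u :=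
    (differentiableAt_const L).clm_comp hdp
  have hN : DifferentiableAt ℝ (fun y => L ∘L fderiv ℝ q y) u :=
    (differentiableAt_const L).clm_comp hdq
  have hM1 : L ∘L fderiv ℝ p u = 1 := by
    ext v
    exact LinearMap.congr_fun hl v
  have hunit : IsUnit (L ∘L fderiv ℝ p u) := by rw [hM1]; exact isUnit_one
  have hev : ∀ᶠ y in 𝓝 u, IsUnit (L ∘L fderiv ℝ p y) :=
    hM.continuousAt.eventually (Units.isOpen.mem_nhds hunit)
  have hinv : DifferentiableAt ℝ
      (fun y => Ring.inverse (L ∘L fderiv ℝ p y) * (L ∘L fderiv ℝ q y)) u :=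
    ((differentiableAt_inverse hunit).comp u hM).mul hN
  refine hinv.congr_of_eventuallyEq ?_
  filter_upwards [hev, hA] with y hy hAy
  have h1 : (L ∘L fderiv ℝ p y) * A y = L ∘L fderiv ℝ q y := by
    ext v
    exact congrArg L (hAy v)
  rw [← h1, ← mul_assoc, Ring.inverse_mul_cancel _ hy, one_mul]

end Calculus

/-! ### Second derivatives of a map with isotropic differential -/

section Local

variable {E W : Type*} [NormedAddCommGroup E] [NormedSpace ℝ E]
  [NormedAddCommGroup W] [NormedSpace ℂ W]

/-- If `dΦ ∘ A = λ dΦ` with `λ` not real and `dΦ` is isotropic, then the second derivative of `Φ` is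
orthogonal to the image of `dΦ`. -/
theorem secondDeriv_orthogonal (H : W →L[ℝ] W →L[ℝ] ℂ)
    (Hsmul : ∀ (c : ℂ) (x y : W), H (c • x) y = c * H x y)
    (Hconj : ∀ x y, H y x = conj (H x y))
    {Φ : E → W} {A : E → E →L[ℝ] E} {lam : ℂ} (hlam : lam.im ≠ 0) {u : E}
    (hΦ : ContDiffAt ℝ 2 Φ u) (hA : DifferentiableAt ℝ A u)
    (hAΦ : ∀ᶠ y in 𝓝 u, ∀ v, fderiv ℝ Φ y (A y v) = lam • fderiv ℝ Φ y v)
    (hiso : ∀ᶠ y in 𝓝 u, ∀ v w, H (fderiv ℝ Φ y v) (fderiv ℝ Φ y w) = 0) (X Y Z : E) :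
    H (fderiv ℝ (fderiv ℝ Φ) u X Y) (fderiv ℝ Φ u Z) = 0 := by
  have hd : DifferentiableAt ℝ (fderiv ℝ Φ) u :=
    (hΦ.fderiv_right (m := 1) (by norm_num)).differentiableAt (by simp)
  set S := fderiv ℝ (fderiv ℝ Φ) u with hS
  set D := fderiv ℝ Φ u with hD
  have hiso0 : ∀ v w, H (D v) (D w) = 0 := hiso.self_of_nhds
  -- Differentiate dΦ(AY) = λ dΦ(Y) along X. The term containing the derivative of A lies in the
  -- image of dΦ, so isotropy removes it.
  have h1 : ∀ X Y Z, H (S X (A u Y)) (D Z) = lam * H (S X Y) (D Z) := by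
    intro X Y Z
    have ha : HasFDerivAt (fun y => A y Y) ((fderiv ℝ A u).flip Y) u := by
      simpa using hA.hasFDerivAt.clm_apply (hasFDerivAt_const Y u)
    have hl := hd.hasFDerivAt.clm_apply ha
    have hr : HasFDerivAt (fun y => lam • fderiv ℝ Φ y Y) (lam • S.flip Y) u :=
      (hasFDerivAt_fderiv_apply hΦ Y).const_smul lam
    have hl' := hr.congr_of_eventuallyEq (hAΦ.mono fun y hy => hy Y)
    have h := congrArg (fun T : E →L[ℝ] W => H (T X) (D Z)) (hl.unique hl')
    simpa [Hsmul, ← hD, ← hS, hiso0] using h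
  have hsymm : ∀ X Y, S X Y = S Y X := fderiv_fderiv_comm hΦ
  have h2 : ∀ X Y Z, H (S X Y) (D Z) = -conj (H (S X Z) (D Y)) := by
    intro X Y Z
    have h := pairing_deriv_eq_zero H (hasFDerivAt_fderiv_apply hΦ Y)
      (hasFDerivAt_fderiv_apply hΦ Z) (hiso.mono fun y hy => hy Y Z) X
    rw [← Hconj]
    exact eq_neg_of_add_eq_zero_left h
  -- Replacing X by AX multiplies the pairing by λ, by symmetry of S. After exchanging Y and Z
  -- through `h2`, which conjugates, the same replacement multiplies it by λ̄.
  have h3 : lam * H (S X Y) (D Z) = conj lam * H (S X Y) (D Z) := by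
    have e1 : H (S (A u X) Y) (D Z) = lam * H (S X Y) (D Z) := by
      rw [hsymm, h1, hsymm Y X]
    have e2 : H (S (A u X) Y) (D Z) = conj lam * H (S X Y) (D Z) := by
      rw [h2, hsymm, h1, hsymm Z X, map_mul, h2 X Y Z]
      ring
    rw [← e1, e2]
  have h4 : lam - conj lam ≠ 0 := by
    intro h
    exact hlam (Complex.conj_eq_iff_im.1 (sub_eq_zero.1 h).symm)
  exact (mul_eq_zero.1 (show (lam - conj lam) * H (S X Y) (D Z) = 0 by
    rw [sub_mul, h3, sub_self])).resolve_left h4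

/-- If the second derivative of `Φ` is orthogonal to the image of `dΦ`, then its Hermitian square
is symmetric under an exchange of arguments. -/
theorem secondDeriv_pairing_symm (H : W →L[ℝ] W →L[ℝ] ℂ) {Φ : E → W} {u : E}
    (hΦ : ContDiffAt ℝ 3 Φ u)
    (horth : ∀ᶠ y in 𝓝 u, ∀ X Y Z,
      H (fderiv ℝ (fderiv ℝ Φ) y X Y) (fderiv ℝ Φ y Z) = 0) (X Y X' Z : E) :
    H (fderiv ℝ (fderiv ℝ Φ) u X Y) (fderiv ℝ (fderiv ℝ Φ) u X' Z) =
      H (fderiv ℝ (fderiv ℝ Φ) u X' Y) (fderiv ℝ (fderiv ℝ Φ) u X Z) := by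
  have hΦ2 : ContDiffAt ℝ 2 Φ u := hΦ.of_le (by norm_num)
  have hev : ∀ᶠ y in 𝓝 u, ContDiffAt ℝ 2 Φ y := hΦ2.eventually (by simp)
  set k : E → W := fun y => fderiv ℝ Φ y Y
  have hk : ContDiffAt ℝ 2 k u :=
    (hΦ.fderiv_right (m := 2) (by norm_num)).clm_apply contDiffAt_const
  have hkd : ∀ᶠ y in 𝓝 u, ∀ v, fderiv ℝ k y v = fderiv ℝ (fderiv ℝ Φ) y v Y := by
    filter_upwards [hev] with y hy v
    rw [(hasFDerivAt_fderiv_apply hy Y).fderiv]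
    rfl
  -- Derivative of `horth` along w. The third-derivative term is symmetric in v and w, hence so is
  -- the other term.
  have key : ∀ v w, H (fderiv ℝ (fderiv ℝ k) u w v) (fderiv ℝ Φ u Z) +
      H (fderiv ℝ (fderiv ℝ Φ) u v Y) (fderiv ℝ (fderiv ℝ Φ) u w Z) = 0 := by
    intro v w
    have h := pairing_deriv_eq_zero H (hasFDerivAt_fderiv_apply hk v)
      (hasFDerivAt_fderiv_apply hΦ2 Z) (c := 0) (by
        filter_upwards [hkd, horth] with y hy ho
        rw [hy]
        exact ho v Y Z) w
    rw [hkd.self_of_nhds] at h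
    exact h
  have e1 := key X X'
  have e2 := key X' X
  rw [fderiv_fderiv_comm hk] at e2
  exact add_left_cancel (e1.trans e2.symm)

end Local

/-! ### The local theorem -/

/-- A local immersed hypersurface with position vector `f` and unit normal `ξ` in a complexified
unit pseudo-sphere, whose shape operator `A` satisfies `(A - λ)(A - conj λ) = 0` with `λ` constant
and not real, has `|λ| = 1`. -/
theorem norm_eq_one_of_local {E W : Type*} [NormedAddCommGroup E] [NormedSpace ℝ E]
    [FiniteDimensional ℝ E] [Nontrivial E] [NormedAddCommGroup W] [NormedSpace ℂ W]
    [FiniteDimensional ℝ W] (H : W →L[ℝ] W →L[ℝ] ℂ)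
    (Hsmul : ∀ (c : ℂ) (x y : W), H (c • x) y = c * H x y)
    (Hconj : ∀ x y, H y x = conj (H x y))
    {f ξ : E → W} {U : Set E} (hU : IsOpen U) {u : E} (hu : u ∈ U)
    (hf : ContDiffOn ℝ 3 f U) (hξ : ContDiffOn ℝ 3 ξ U)
    (hff : H (f u) (f u) = 1) (hξξ : H (ξ u) (ξ u) = 1 ∨ H (ξ u) (ξ u) = -1)
    (hξf : ∀ y ∈ U, H (ξ y) (f y) = 0)
    (hdff : ∀ y ∈ U, ∀ v, H (fderiv ℝ f y v) (f y) = 0)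
    (hdfξ : ∀ y ∈ U, ∀ v, H (fderiv ℝ f y v) (ξ y) = 0)
    (hreal : ∀ y ∈ U, ∀ v w,
      H (fderiv ℝ f y v) (fderiv ℝ f y w) = H (fderiv ℝ f y w) (fderiv ℝ f y v))
    (hinj : ∀ y ∈ U, Function.Injective (fderiv ℝ f y))
    (hrange : ∀ w, H w (f u) = 0 → H w (ξ u) = 0 →
      ∃ a b, w = fderiv ℝ f u a + Complex.I • fderiv ℝ f u b)
    (hnd : ∀ v, (∀ z, H (fderiv ℝ f u v) (fderiv ℝ f u z) = 0) → v = 0)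
    {A : E → E →L[ℝ] E} {lam : ℂ} (hlam : lam.im ≠ 0)
    (hA : ∀ y ∈ U, ∀ v, fderiv ℝ ξ y v = -fderiv ℝ f y (A y v))
    (hA2 : ∀ y ∈ U, ∀ v, A y (A y v) = (2 * lam.re) • A y v - Complex.normSq lam • v) :
    ‖lam‖ = 1 := by
  have Hsmul' : ∀ (c : ℂ) (x y : W), H x (c • y) = conj c * H x y := by
    intro c x y
    rw [Hconj, Hsmul, map_mul, ← Hconj]
  have hnhds : ∀ {y}, y ∈ U → ∀ᶠ z in 𝓝 y, z ∈ U := fun hy => hU.mem_nhds hy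
  have hfat : ∀ {y}, y ∈ U → ContDiffAt ℝ 3 f y := fun hy => hf.contDiffAt (hU.mem_nhds hy)
  have hξat : ∀ {y}, y ∈ U → ContDiffAt ℝ 3 ξ y := fun hy => hξ.contDiffAt (hU.mem_nhds hy)
  have h23 : (2 : WithTop ℕ∞) ≤ 3 := by norm_num
  have hfd : ∀ {y}, y ∈ U → HasFDerivAt f (fderiv ℝ f y) y := fun hy =>
    ((hfat hy).differentiableAt (by simp)).hasFDerivAt
  have hξd : ∀ {y}, y ∈ U → HasFDerivAt ξ (fderiv ℝ ξ y) y := fun hy =>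
    ((hξat hy).differentiableAt (by simp)).hasFDerivAt
  have hsum : ((2 * lam.re : ℝ) : ℂ) = lam + conj lam := (Complex.add_conj lam).symm
  have hprod : ((Complex.normSq lam : ℝ) : ℂ) = lam * conj lam := (Complex.mul_conj lam).symm
  have hfA2 : ∀ y ∈ U, ∀ v, fderiv ℝ f y (A y (A y v)) =
      (lam + conj lam) • fderiv ℝ f y (A y v) - (lam * conj lam) • fderiv ℝ f y v := by
    intro y hy v
    rw [hA2 y hy, map_sub, map_smul, map_smul, ← hsum, ← hprod, Complex.coe_smul,
      Complex.coe_smul]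
  -- the shape operator is self-adjoint
  have hadj : ∀ y ∈ U, ∀ v w, H (fderiv ℝ f y (A y v)) (fderiv ℝ f y w) =
      H (fderiv ℝ f y v) (fderiv ℝ f y (A y w)) := by
    intro y hy v w
    have key : ∀ v w, H (fderiv ℝ (fderiv ℝ f) y v w) (ξ y) =
        H (fderiv ℝ f y w) (fderiv ℝ f y (A y v)) := by
      intro v w
      have h := pairing_deriv_eq_zero H (hasFDerivAt_fderiv_apply ((hfat hy).of_le h23) w) (hξd hy)
        ((hnhds hy).mono fun z hz => hdfξ z hz w) v
      rw [hA y hy, map_neg, ← sub_eq_add_neg, sub_eq_zero] at h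
      exact h
    rw [hreal y hy, ← key, fderiv_fderiv_comm ((hfat hy).of_le h23), key]
  have hdξf : ∀ y ∈ U, ∀ v, H (fderiv ℝ ξ y v) (f y) = 0 := by
    intro y hy v
    rw [hA y hy, map_neg, neg_apply, hdff y hy, neg_zero]
  have hdξξ : ∀ y ∈ U, ∀ v, H (fderiv ℝ ξ y v) (ξ y) = 0 := by
    intro y hy v
    rw [hA y hy, map_neg, neg_apply, hdfξ y hy, neg_zero]
  -- the isotropic map
  set Φ : E → W := fun y => ξ y + conj lam • f y with hΦdef
  have hΦat : ∀ {y}, y ∈ U → ContDiffAt ℝ 3 Φ y := fun hy =>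
    (hξat hy).add ((hfat hy).const_smul (conj lam))
  have hDξ : ∀ y ∈ U, ∀ v, fderiv ℝ Φ y v = fderiv ℝ ξ y v + conj lam • fderiv ℝ f y v := by
    intro y hy v
    have h : HasFDerivAt Φ (fderiv ℝ ξ y + conj lam • fderiv ℝ f y) y :=
      (hξd hy).add ((hfd hy).const_smul (conj lam))
    rw [h.fderiv]
    rfl
  have hD : ∀ y ∈ U, ∀ v,
      fderiv ℝ Φ y v = conj lam • fderiv ℝ f y v - fderiv ℝ f y (A y v) := by
    intro y hy v
    rw [hDξ y hy, hA y hy]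
    abel
  have hDA : ∀ y ∈ U, ∀ v, fderiv ℝ Φ y (A y v) = lam • fderiv ℝ Φ y v := by
    intro y hy v
    rw [hD y hy, hD y hy, hfA2 y hy]
    module
  -- Self-adjointness of A turns the left side into H(df((A - λ)(A - λ̄)v), df w), read
  -- complex-linearly.
  have hiso : ∀ y ∈ U, ∀ v w, H (fderiv ℝ Φ y v) (fderiv ℝ Φ y w) = 0 := by
    intro y hy v w
    have h1 : H (fderiv ℝ f y (A y v)) (fderiv ℝ f y (A y w)) =
        (lam + conj lam) * H (fderiv ℝ f y (A y v)) (fderiv ℝ f y w) -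
          (lam * conj lam) * H (fderiv ℝ f y v) (fderiv ℝ f y w) := by
      rw [← hadj y hy, hfA2 y hy, map_sub, sub_apply, Hsmul, Hsmul]
    simp only [hD y hy, map_sub, sub_apply, Hsmul, Hsmul', h1, ← hadj y hy v w,
      Complex.conj_conj]
    ring
  have hDf : ∀ y ∈ U, ∀ v, H (fderiv ℝ Φ y v) (f y) = 0 := by
    intro y hy v
    rw [hDξ y hy, map_add, add_apply, Hsmul, hdξf y hy, hdff y hy, mul_zero,
      add_zero]
  have hDξ0 : ∀ y ∈ U, ∀ v, H (fderiv ℝ Φ y v) (ξ y) = 0 := by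
    intro y hy v
    rw [hDξ y hy, map_add, add_apply, Hsmul, hdξξ y hy, hdfξ y hy, mul_zero,
      add_zero]
  have hAdiff : ∀ y ∈ U, DifferentiableAt ℝ A y := by
    intro y hy
    refine differentiableAt_of_fderiv_comp_eq (q := fun z => -ξ z) ((hfat hy).of_le h23)
      ((hξat hy).of_le h23).neg (hinj y hy) ((hnhds hy).mono fun z hz v => ?_)
    have h : HasFDerivAt (fun z => -ξ z) (-fderiv ℝ ξ z) z := (hξd hz).neg
    rw [h.fderiv, neg_apply, hA z hz, neg_neg]
  have horth : ∀ y ∈ U, ∀ X Y Z,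
      H (fderiv ℝ (fderiv ℝ Φ) y X Y) (fderiv ℝ Φ y Z) = 0 := fun y hy =>
    secondDeriv_orthogonal H Hsmul Hconj hlam ((hΦat hy).of_le h23) (hAdiff y hy)
      ((hnhds hy).mono hDA) ((hnhds hy).mono hiso)
  have hsymmQ := secondDeriv_pairing_symm H (hΦat hu) ((hnhds hu).mono horth)
  -- from here on everything happens at `u`
  have hΦ2 : ContDiffAt ℝ 2 Φ u := (hΦat hu).of_le h23
  set S := fderiv ℝ (fderiv ℝ Φ) u with hSdef
  -- Up to factors, m gives the components of S along both f and ξ. It inherits the symmetry of S,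
  -- and so is multiplied by λ when A is applied to either argument.
  set m : E → E → ℂ := fun X Y => H (fderiv ℝ Φ u Y) (fderiv ℝ f u X) with hm
  have hSf : ∀ X Y, H (S X Y) (f u) = -m X Y := fun X Y =>
    eq_neg_of_add_eq_zero_left (pairing_deriv_eq_zero H (hasFDerivAt_fderiv_apply hΦ2 Y) (hfd hu)
      ((hnhds hu).mono fun z hz => hDf z hz Y) X)
  have hmsymm : ∀ X Y, m X Y = m Y X := by
    intro X Y
    rw [← neg_inj, ← hSf, ← hSf, hSdef, fderiv_fderiv_comm hΦ2]
  have hmA' : ∀ X Y, m X (A u Y) = lam * m X Y := by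
    intro X Y
    simp only [hm, hDA u hu, Hsmul]
  have hmA : ∀ X Y, m (A u X) Y = lam * m X Y := by
    intro X Y
    rw [hmsymm, hmA', hmsymm]
  have hSξ : ∀ X Y, H (S X Y) (ξ u) = lam * m X Y := by
    intro X Y
    have h := pairing_deriv_eq_zero H (hasFDerivAt_fderiv_apply hΦ2 Y) (hξd hu)
      ((hnhds hu).mono fun z hz => hDξ0 z hz Y) X
    rw [hA u hu, map_neg, ← sub_eq_add_neg, sub_eq_zero] at h
    rw [← hmA]
    exact h
  obtain ⟨ε, hε, hξε⟩ : ∃ ε : ℝ, (ε = 1 ∨ ε = -1) ∧ H (ξ u) (ξ u) = ε := by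
    rcases hξξ with h | h
    · exact ⟨1, Or.inl rfl, by simp [h]⟩
    · exact ⟨-1, Or.inr rfl, by simp [h]⟩
  have hεε : (ε : ℂ) * ε = 1 := by rcases hε with rfl | rfl <;> norm_num
  have hfξ : H (f u) (ξ u) = 0 := by rw [Hconj, hξf u hu, map_zero]
  have hfD : ∀ Z, H (f u) (fderiv ℝ Φ u Z) = 0 := fun Z => by
    rw [Hconj, hDf u hu, map_zero]
  have hξD : ∀ Z, H (ξ u) (fderiv ℝ Φ u Z) = 0 := fun Z => by
    rw [Hconj, hDξ0 u hu, map_zero]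
  -- T is the tangential part of S. The coefficient of ξ is the pairing λm divided by ⟨ξ, ξ⟩ = ε,
  -- and 1/ε = ε.
  set T : E → E → W := fun X Y => S X Y + m X Y • f u - (ε * lam * m X Y) • ξ u with hT
  have hTf : ∀ X Y, H (T X Y) (f u) = 0 := by
    intro X Y
    simp only [hT, map_add, map_sub, add_apply, sub_apply,
      Hsmul, hSf, hff, hξf u hu]
    ring
  have hTξ : ∀ X Y, H (T X Y) (ξ u) = 0 := by
    intro X Y
    simp only [hT, map_add, map_sub, add_apply, sub_apply,
      Hsmul, hSξ, hfξ, hξε]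
    linear_combination (-lam * m X Y) * hεε
  have hTD : ∀ X Y Z, H (T X Y) (fderiv ℝ Φ u Z) = 0 := by
    intro X Y Z
    simp only [hT, map_add, map_sub, add_apply, sub_apply,
      Hsmul, hfD, hξD]
    rw [horth u hu]
    ring
  have himC : (lam.im : ℂ) ≠ 0 := by exact_mod_cast hlam
  -- T is orthogonal to the λ-eigenspace, which is its own orthogonal complement in the complex
  -- tangent space, so T lies in it.
  have hTmem : ∀ X Y, ∃ a, (lam.im : ℂ) • T X Y = Complex.I • fderiv ℝ Φ u a := by
    intro X Y
    obtain ⟨a, b, hab⟩ := hrange _ (hTf X Y) (hTξ X Y)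
    -- This is the real part of H(T, dΦ z) = 0 for T = df a + i df b, obtained as half the sum of
    -- that equation and its conjugate.
    have hz : lam.re • a - A u a - lam.im • b = 0 := by
      refine hnd _ fun z => ?_
      have h := hTD X Y z
      have hcd : ∀ v w, conj (H (fderiv ℝ f u v) (fderiv ℝ f u w)) =
          H (fderiv ℝ f u v) (fderiv ℝ f u w) := fun v w => by rw [← Hconj, hreal u hu]
      rw [hab, hD u hu] at h
      simp only [map_add, map_sub, add_apply, Hsmul, Hsmul', ← hadj u hu,
        Complex.conj_conj] at h
      have h' := congrArg conj h
      simp only [map_add, map_sub, map_mul, hcd, Complex.conj_I, map_zero] at h'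
      simp only [map_sub, map_smul, sub_apply, smul_apply,
        Complex.real_smul]
      have hre : (lam.re : ℂ) = (lam + conj lam) / 2 := by rw [Complex.add_conj]; push_cast; ring
      have him : (lam.im : ℂ) = -Complex.I * (lam - conj lam) / 2 := by
        rw [Complex.sub_conj]; push_cast; linear_combination (lam.im : ℂ) * Complex.I_mul_I
      rw [hre, him]
      linear_combination (1 / 2 : ℂ) * h + (1 / 2 : ℂ) * h'
    have hb : (lam.im : ℂ) • fderiv ℝ f u b =
        (lam.re : ℂ) • fderiv ℝ f u a - fderiv ℝ f u (A u a) := by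
      have h := congrArg (fderiv ℝ f u) hz
      simp only [map_sub, map_smul, map_zero] at h
      rw [Complex.coe_smul, Complex.coe_smul]
      exact (sub_eq_zero.1 h).symm
    refine ⟨a, ?_⟩
    have hconj : conj lam = lam.re - lam.im * Complex.I := by
      apply Complex.ext <;> simp
    have e : (lam.im : ℂ) • T X Y = (lam.im : ℂ) • fderiv ℝ f u a +
        Complex.I • ((lam.im : ℂ) • fderiv ℝ f u b) := by rw [hab]; module
    rw [e, hb, hD u hu, hconj]
    have hI : (lam.im : ℂ) = -(Complex.I * (lam.im * Complex.I)) := by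
      linear_combination (lam.im : ℂ) * Complex.I_mul_I
    nth_rewrite 1 [hI]
    module
  have hTT : ∀ X Y X' Z, H (T X Y) (T X' Z) = 0 := by
    intro X Y X' Z
    obtain ⟨a, ha⟩ := hTmem X Y
    have h : (lam.im : ℂ) * H (T X Y) (T X' Z) = 0 := by
      rw [← Hsmul, ha, Hsmul, Hconj, hTD, map_zero, mul_zero]
    exact (mul_eq_zero.1 h).resolve_left himC
  have hSS : ∀ X Y X' Z, H (S X Y) (S X' Z) =
      (1 + ε * (lam * conj lam)) * (m X Y * conj (m X' Z)) := by
    intro X Y X' Z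
    have hS : ∀ X Y, S X Y = T X Y - m X Y • f u + (ε * lam * m X Y) • ξ u := by
      intro X Y
      simp only [hT]
      abel
    have hfT : H (f u) (T X' Z) = 0 := by rw [Hconj, hTf, map_zero]
    have hξT : H (ξ u) (T X' Z) = 0 := by rw [Hconj, hTξ, map_zero]
    rw [hS X Y, hS X' Z]
    simp only [map_add, map_sub, add_apply, sub_apply,
      Hsmul, Hsmul', hTT, hTf, hTξ, hfT, hξT, hff, hξε, hfξ, hξf u hu, map_mul, Complex.conj_ofReal]
    linear_combination (ε * lam * conj lam * m X Y * conj (m X' Z)) * hεε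
  have hk : 1 + (ε : ℂ) * (lam * conj lam) = 0 := by
    by_contra hk
    have hsw : ∀ X Y X' Z, m X Y * conj (m X' Z) = m X' Y * conj (m X Z) := by
      intro X Y X' Z
      have h := hsymmQ X Y X' Z
      rw [hSS, hSS] at h
      exact mul_left_cancel₀ hk h
    have hne : lam - conj lam ≠ 0 := fun h =>
      hlam (Complex.conj_eq_iff_im.1 (sub_eq_zero.1 h).symm)
    have hm0 : ∀ X Y, m X Y = 0 := by
      intro X Y
      -- With AX and X in the exchanged slots and Z = Y, the symmetry reads λ|m|² = λ̄|m|².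
      have h := hsw (A u X) Y X Y
      rw [hmA, map_mul] at h
      have h' : (lam - conj lam) * (m X Y * conj (m X Y)) = 0 := by linear_combination h
      simpa [hne] using h'
    obtain ⟨v, hv⟩ := exists_ne (0 : E)
    refine hv (hnd v fun z => ?_)
    -- m(z,v) = 0 says ⟨Av, z⟩ = λ̄⟨v, z⟩, and the conjugate of m(v,z) = 0 says ⟨Av, z⟩ = λ⟨v, z⟩.
    -- Hence ⟨v, z⟩ = 0 for all z.
    have h1 := hm0 z v
    have h2 := hm0 v z
    simp only [hm, hD u hu, map_sub, sub_apply, Hsmul] at h1 h2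
    have h3 := congrArg conj h2
    simp only [map_sub, map_mul, Complex.conj_conj, ← Hconj, map_zero] at h3
    rw [← hadj u hu] at h3
    have h' : (lam - conj lam) * H (fderiv ℝ f u v) (fderiv ℝ f u z) = 0 := by
      linear_combination h3 - h1
    exact (mul_eq_zero.1 h').resolve_left hne
  have hk' : 1 + ε * Complex.normSq lam = 0 := by
    rw [← hprod] at hk
    exact_mod_cast hk
  have hn : Complex.normSq lam = 1 := by
    -- ε = 1 is impossible, since 1 + |λ|² > 0.
    rcases hε with rfl | rfl
    · have := Complex.normSq_nonneg lam
      linarith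
    · linarith
  rw [Complex.normSq_eq_norm_sq] at hn
  exact (pow_eq_one_iff_of_nonneg (norm_nonneg lam) two_ne_zero).1 hn

/-! ### The Hermitian extension of the pseudo-inner product -/

section Complexification

/-- The inclusion `ℝ^m → ℂ^m`. -/
def complexify (m : ℕ) : Coord m →L[ℝ] (Fin m → ℂ) :=
  LinearMap.toContinuousLinearMap
    { toFun := fun v i => (v i : ℂ)
      map_add' := fun u v => by ext i; simp
      map_smul' := fun c v => by ext i; simp }

theorem complexify_apply (m : ℕ) (v : Coord m) (i : Fin m) : complexify m v i = (v i : ℂ) := rfl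

theorem complexify_injective (m : ℕ) : Function.Injective (complexify m) := by
  intro u v h
  ext i
  exact Complex.ofReal_injective (congrFun h i)

theorem exists_eq_complexify_add (m : ℕ) (w : Fin m → ℂ) :
    ∃ a b : Coord m, w = complexify m a + Complex.I • complexify m b := by
  refine ⟨WithLp.toLp 2 fun i => (w i).re, WithLp.toLp 2 fun i => (w i).im, ?_⟩
  ext i
  simp only [Pi.add_apply, Pi.smul_apply, complexify_apply, smul_eq_mul]
  rw [mul_comm]
  exact (Complex.re_add_im (w i)).symm

/-- The Hermitian extension of the pseudo-inner product to `ℂ^m`. -/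
def hermitianExt (m s : ℕ) : (Fin m → ℂ) →L[ℝ] (Fin m → ℂ) →L[ℝ] ℂ :=
  LinearMap.toContinuousLinearMap
    ((LinearMap.toContinuousLinearMap (𝕜 := ℝ) (E := Fin m → ℂ) (F' := ℂ)).toLinearMap ∘ₗ
      LinearMap.mk₂ ℝ (fun u v : Fin m → ℂ =>
          ∑ i : Fin m, (if (i : ℕ) < s then (-1 : ℂ) else 1) * (u i * conj (v i)))
        (fun u u' v => by
          rw [← Finset.sum_add_distrib]
          exact Finset.sum_congr rfl fun i _ => by simp only [Pi.add_apply]; ring)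
        (fun c u v => by
          rw [Finset.smul_sum]
          exact Finset.sum_congr rfl fun i _ => by
            simp only [Pi.smul_apply, Complex.real_smul]; ring)
        (fun u v v' => by
          rw [← Finset.sum_add_distrib]
          exact Finset.sum_congr rfl fun i _ => by simp only [Pi.add_apply, map_add]; ring)
        (fun c u v => by
          rw [Finset.smul_sum]
          exact Finset.sum_congr rfl fun i _ => by
            simp only [Pi.smul_apply, Complex.real_smul, map_mul, Complex.conj_ofReal]; ring))

theorem hermitianExt_apply (m s : ℕ) (u v : Fin m → ℂ) : hermitianExt m s u v =
    ∑ i : Fin m, (if (i : ℕ) < s then (-1 : ℂ) else 1) * (u i * conj (v i)) := rfl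

theorem hermitianExt_smul_left (m s : ℕ) (c : ℂ) (u v : Fin m → ℂ) :
    hermitianExt m s (c • u) v = c * hermitianExt m s u v := by
  simp only [hermitianExt_apply, Finset.mul_sum, Pi.smul_apply, smul_eq_mul]
  exact Finset.sum_congr rfl fun i _ => by ring

theorem hermitianExt_conj (m s : ℕ) (u v : Fin m → ℂ) :
    hermitianExt m s v u = conj (hermitianExt m s u v) := by
  simp only [hermitianExt_apply, map_sum, map_mul, Complex.conj_conj]
  refine Finset.sum_congr rfl fun i _ => ?_
  split_ifs <;> simp <;> ring

theorem hermitianExt_complexify (m s : ℕ) (u v : Coord m) :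
    hermitianExt m s (complexify m u) (complexify m v) = (pseudoInner m s u v : ℂ) := by
  simp only [hermitianExt_apply, pseudoInner_apply, complexify_apply, Complex.conj_ofReal,
    Complex.ofReal_sum]
  refine Finset.sum_congr rfl fun i _ => ?_
  split_ifs <;> simp

end Complexification

/-! ### Eigenvalues and quadratic relation for Petrov type II -/

section Petrov

open Polynomial in
/-- The complex eigenvalues of an endomorphism of Petrov type II. -/
theorem roots_charpoly_of_toMatrix {V : Type*} [AddCommGroup V] [Module ℝ V] [Module.Finite ℝ V]
    {A : Module.End ℝ V} (b : Module.Basis (Fin 4) ℝ V) {α₁ β₁ α₂ β₂ : ℝ}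
    (hA : LinearMap.toMatrix b b A =
      !![α₁, -β₁, 0, 0;
         β₁, α₁, 0, 0;
         0, 0, α₂, -β₂;
         0, 0, β₂, α₂]) :
    (A.charpoly.map (algebraMap ℝ ℂ)).roots =
      ({⟨α₁, β₁⟩, ⟨α₁, -β₁⟩, ⟨α₂, β₂⟩, ⟨α₂, -β₂⟩} : Multiset ℂ) := by
  have h1 : A.charpoly = ((X - C α₁) ^ 2 + C β₁ ^ 2) * ((X - C α₂) ^ 2 + C β₂ ^ 2) := by
    rw [← LinearMap.charpoly_toMatrix A b, hA, Matrix.charpoly]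
    simp [Matrix.charmatrix_apply, Matrix.det_succ_row_zero, Fin.sum_univ_succ, Fin.succAbove]
    ring
  have hq : ∀ α β : ℝ, ((X - C α) ^ 2 + C β ^ 2 : ℝ[X]).map (algebraMap ℝ ℂ) =
      (X - C (⟨α, β⟩ : ℂ)) * (X - C (⟨α, -β⟩ : ℂ)) := by
    intro α β
    have e1 : (⟨α, β⟩ : ℂ) = α + β * Complex.I := by apply Complex.ext <;> simp
    have e2 : (⟨α, -β⟩ : ℂ) = α - β * Complex.I := by apply Complex.ext <;> simp
    have e3 : (C Complex.I : ℂ[X]) * C Complex.I = -1 := by rw [← C_mul, Complex.I_mul_I]; simp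
    rw [e1, e2]
    simp only [Polynomial.map_add, Polynomial.map_pow, Polynomial.map_sub, map_X, map_C, map_add,
      map_sub, map_mul, Complex.coe_algebraMap]
    linear_combination (C (β : ℂ)) ^ 2 * e3
  have h2 : A.charpoly.map (algebraMap ℝ ℂ) =
      (({⟨α₁, β₁⟩, ⟨α₁, -β₁⟩, ⟨α₂, β₂⟩, ⟨α₂, -β₂⟩} : Multiset ℂ).map fun r => X - C r).prod := by
    rw [h1, Polynomial.map_mul, hq, hq]
    simp [mul_assoc]
  rw [h2, roots_multiset_prod_X_sub_C]

/-- If a non-real eigenvalue `λ` of an endomorphism of Petrov type II has multiplicity two, then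
the endomorphism is annihilated by `(X - λ)(X - conj λ)`. -/
theorem IsPetrovTypeII.apply_apply {V : Type*} [AddCommGroup V] [Module ℝ V] [Module.Finite ℝ V]
    {A : Module.End ℝ V} {B : LinearMap.BilinForm ℝ V} (h : IsPetrovTypeII A B) {lam : ℂ}
    (him : lam.im ≠ 0) (hcount : (A.charpoly.map (algebraMap ℝ ℂ)).roots.count lam = 2) (v : V) :
    A (A v) = (2 * lam.re) • A v - Complex.normSq lam • v := by
  obtain ⟨b, α₁, β₁, α₂, β₂, hβ₁, hβ₂, hA, -⟩ := h
  rw [roots_charpoly_of_toMatrix b hA] at hcount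
  have key : (α₁ = lam.re ∧ β₁ * β₁ = lam.im * lam.im) ∧
      (α₂ = lam.re ∧ β₂ * β₂ = lam.im * lam.im) := by
    obtain ⟨a, c⟩ := lam
    simp only [Multiset.insert_eq_cons, Multiset.count_cons, Multiset.count_singleton,
      Complex.mk.injEq] at hcount
    -- Since the β's are positive, the sign of Im λ leaves one candidate eigenvalue per block.
    -- Multiplicity 2 requires both to equal λ.
    rcases lt_or_gt_of_ne him with hc | hc
    · have n1 : c ≠ β₁ := by intro h; simp only at hc; linarith
      have n2 : c ≠ β₂ := by intro h; simp only at hc; linarith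
      simp only [n1, n2, and_false, if_false] at hcount
      split_ifs at hcount with h1 h2 <;> first | omega | skip
      exact ⟨⟨h2.1.symm, by rw [h2.2]; ring⟩, ⟨h1.1.symm, by rw [h1.2]; ring⟩⟩
    · have n1 : c ≠ -β₁ := by intro h; simp only at hc; linarith
      have n2 : c ≠ -β₂ := by intro h; simp only at hc; linarith
      simp only [n1, n2, and_false, if_false] at hcount
      split_ifs at hcount with h1 h2 <;> first | omega | skip
      exact ⟨⟨h2.1.symm, by rw [h2.2]⟩, ⟨h1.1.symm, by rw [h1.2]⟩⟩
  obtain ⟨⟨rfl, h1⟩, ⟨h2, h3⟩⟩ := key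
  have hAA : A * A = (2 * lam.re) • A - Complex.normSq lam • (1 : Module.End ℝ V) := by
    apply (LinearMap.toMatrix b b).injective
    rw [map_sub, map_smul, map_smul, LinearMap.toMatrix_mul, hA, LinearMap.toMatrix_one,
      Complex.normSq_apply, ← h1]
    ext i j
    fin_cases i <;> fin_cases j <;> simp [Matrix.mul_apply, Fin.sum_univ_succ, h2] <;>
      linarith
  exact LinearMap.congr_fun hAA v

end Petrov

/-! ### Local expressions in a chart -/

section Chart

variable {n : ℕ} {M : Type*} [TopologicalSpace M] [ChartedSpace (EuclideanSpace ℝ (Fin n)) M]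

/-- The local expression of a map to `ℝ^m`, with values in `ℂ^m`. -/
def chartExpr {m : ℕ} (g : M → Coord m) (x₀ : M) (y : EuclideanSpace ℝ (Fin n)) : Fin m → ℂ :=
  complexify m (g ((extChartAt (𝓡 n) x₀).symm y))

theorem chartExpr_apply {m : ℕ} (g : M → Coord m) (x₀ : M) (y : EuclideanSpace ℝ (Fin n)) :
    chartExpr g x₀ y = complexify m (g ((extChartAt (𝓡 n) x₀).symm y)) := rfl

variable [IsManifold (𝓡 n) ∞ M]

theorem contDiffOn_chartExpr {m : ℕ} {g : M → Coord m} (hg : ContMDiff (𝓡 n) 𝓘(ℝ, Coord m) ∞ g)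
    (x₀ : M) : ContDiffOn ℝ 3 (chartExpr g x₀) (extChartAt (𝓡 n) x₀).target := by
  have h1 := contMDiffOn_extChartAt_symm (I := 𝓡 n) (n := ∞) x₀
  have h2 := (hg.comp_contMDiffOn h1).contDiffOn
  exact (complexify m).contDiff.comp_contDiffOn (h2.of_le (WithTop.coe_le_coe.2 (le_top : (3 : ℕ∞) ≤ ⊤)))

theorem fderiv_chartExpr {m : ℕ} {g : M → Coord m} (hg : ContMDiff (𝓡 n) 𝓘(ℝ, Coord m) ∞ g)
    (x₀ : M) {y : EuclideanSpace ℝ (Fin n)} (hy : y ∈ (extChartAt (𝓡 n) x₀).target)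
    (v : EuclideanSpace ℝ (Fin n)) :
    fderiv ℝ (chartExpr g x₀) y v = complexify m
      (mfderiv (𝓡 n) 𝓘(ℝ, Coord m) g ((extChartAt (𝓡 n) x₀).symm y)
        (mfderiv 𝓘(ℝ, EuclideanSpace ℝ (Fin n)) (𝓡 n) (extChartAt (𝓡 n) x₀).symm y v)) := by
  have hs : MDifferentiableAt 𝓘(ℝ, EuclideanSpace ℝ (Fin n)) (𝓡 n)
      (extChartAt (𝓡 n) x₀).symm y :=
    ((contMDiffOn_extChartAt_symm (I := 𝓡 n) (n := ∞) x₀).contMDiffAt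
      ((isOpen_extChartAt_target x₀).mem_nhds hy)).mdifferentiableAt (by simp)
  have hgd : MDifferentiableAt (𝓡 n) 𝓘(ℝ, Coord m) g ((extChartAt (𝓡 n) x₀).symm y) :=
    (hg _).mdifferentiableAt (by simp)
  have h := (hgd.hasMFDerivAt.comp y hs.hasMFDerivAt).hasFDerivAt
  have h' := (complexify m).hasFDerivAt.comp y h
  have h'' : HasFDerivAt (chartExpr g x₀) _ y := h'
  rw [h''.fderiv]
  rfl

theorem isInvertible_mfderiv_extChartAt_symm (x₀ : M) {y : EuclideanSpace ℝ (Fin n)}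
    (hy : y ∈ (extChartAt (𝓡 n) x₀).target) :
    (mfderiv 𝓘(ℝ, EuclideanSpace ℝ (Fin n)) (𝓡 n)
      (extChartAt (𝓡 n) x₀).symm y).IsInvertible := by
  have : IsManifold (𝓡 n) 1 M := IsManifold.of_le (n := ∞) (by simp)
  have h := isInvertible_mfderivWithin_extChartAt_symm (I := 𝓡 n) hy
  rwa [ModelWithCorners.range_eq_univ, mfderivWithin_univ] at h

end Chart

/-! ### From the hypersurface to the local theorem -/

namespace Hypersurface

variable {n s : ℕ} {M : Type*} [TopologicalSpace M] [ChartedSpace (EuclideanSpace ℝ (Fin n)) M]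

theorem pseudoInner_tangentMap_toFun (F : Hypersurface n s M) (x : M)
    (v : TangentSpace (𝓡 n) x) :
    pseudoInner (n + 1 + 1) s (F.tangentMap x v) (F.toFun x) = 0 :=
  pseudoInner_mfderiv_self F.toFun F.smooth x 1 (Filter.Eventually.of_forall F.pseudoInner_toFun) v

theorem pseudoInner_tangentMap_normal (F : Hypersurface n s M) (x : M)
    (v : TangentSpace (𝓡 n) x) :
    pseudoInner (n + 1 + 1) s (F.tangentMap x v) (F.normal x) = 0 := by
  rw [pseudoInner_comm]
  exact F.normal_orthogonal x v

/-- The induced metric is non-degenerate. -/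
theorem eq_zero_of_metric_eq_zero (F : Hypersurface n s M) (x : M) (v : TangentSpace (𝓡 n) x)
    (h : ∀ w, pseudoInner (n + 1 + 1) s (F.tangentMap x v) (F.tangentMap x w) = 0) : v = 0 := by
  set B := pseudoInner (n + 1 + 1) s with hB
  have hv : F.tangentMap x v = 0 := by
    refine (pseudoInner_nondegenerate (n + 1 + 1) s).1 _ fun w => ?_
    -- Split an arbitrary w into components along position and normal plus a tangent remainder. A
    -- tangent vector pairs to zero with the first two.
    set c := B w (F.normal x) / B (F.normal x) (F.normal x) with hc
    have hfn : B (F.toFun x) (F.normal x) = 0 := by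
      rw [hB, pseudoInner_comm]; exact F.normal_tangent x
    obtain ⟨z, hz⟩ := F.tangentMap_range x
      (w - B w (F.toFun x) • F.toFun x - c • F.normal x)
      (by
        rw [LinearMap.map_sub₂, LinearMap.map_sub₂, LinearMap.map_smul₂, LinearMap.map_smul₂,
          F.pseudoInner_toFun, F.normal_tangent, ← hB]
        simp)
      (by
        rw [LinearMap.map_sub₂, LinearMap.map_sub₂, LinearMap.map_smul₂, LinearMap.map_smul₂,
          ← hB, hfn, hc, smul_eq_mul, smul_eq_mul, div_mul_cancel₀ _ (F.normal_ne_zero_sq x)]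
        ring)
    have hw : w = F.tangentMap x z + B w (F.toFun x) • F.toFun x + c • F.normal x := by
      rw [hz]; abel
    rw [hw, map_add, map_add, map_smul, map_smul, h, ← hB, hB,
      F.pseudoInner_tangentMap_toFun, F.pseudoInner_tangentMap_normal]
    simp
  exact F.immersion x (hv.trans (map_zero (F.tangentMap x)).symm)

variable [IsManifold (𝓡 n) ∞ M]

/-- A hypersurface of a pseudo-sphere whose shape operator satisfies `(A - λ)(A - conj λ) = 0`,
for a constant `λ` that is not real, has `|λ| = 1`. -/
theorem norm_eq_one_of_shapeOperator [NeZero n] (F : Hypersurface n s M) (x₀ : M) {lam : ℂ}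
    (him : lam.im ≠ 0)
    (hA2 : ∀ (x : M) (v : TangentSpace (𝓡 n) x), F.shapeOperator x (F.shapeOperator x v) =
      (2 * lam.re) • F.shapeOperator x v - Complex.normSq lam • v) : ‖lam‖ = 1 := by
  set φ := extChartAt (𝓡 n) x₀
  set u := φ x₀
  have hu : u ∈ φ.target := mem_extChartAt_target x₀
  let D : (y : EuclideanSpace ℝ (Fin n)) →
      EuclideanSpace ℝ (Fin n) →L[ℝ] TangentSpace (𝓡 n) (φ.symm y) :=
    fun y => mfderiv 𝓘(ℝ, EuclideanSpace ℝ (Fin n)) (𝓡 n) φ.symm y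
  have hDinv : ∀ y ∈ φ.target, (D y).IsInvertible := fun y hy =>
    isInvertible_mfderiv_extChartAt_symm x₀ hy
  have hf : ∀ y ∈ φ.target, ∀ v, fderiv ℝ (chartExpr F.toFun x₀) y v =
      complexify _ (F.tangentMap (φ.symm y) (D y v)) := fun y hy v =>
    fderiv_chartExpr F.smooth x₀ hy v
  have hξ : ∀ y ∈ φ.target, ∀ v, fderiv ℝ (chartExpr F.normal x₀) y v =
      -complexify _ (F.tangentMap (φ.symm y) (F.shapeOperator (φ.symm y) (D y v))) := by
    intro y hy v
    have hξ' : fderiv ℝ (chartExpr F.normal x₀) y v =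
        complexify _ (F.flatDerivNormal (φ.symm y) (D y v)) :=
      fderiv_chartExpr F.normal_smooth x₀ hy v
    have hnhds := (isOpen_extChartAt_target (I := 𝓡 n) x₀).mem_nhds hy
    have hd : ∀ {g : M → Coord (n + 1 + 1)}, ContMDiff (𝓡 n) 𝓘(ℝ, Coord (n + 1 + 1)) ∞ g →
        HasFDerivAt (chartExpr g x₀) (fderiv ℝ (chartExpr g x₀) y) y := fun hg =>
      (((contDiffOn_chartExpr hg x₀).contDiffAt hnhds).differentiableAt (by simp)).hasFDerivAt
    -- Differentiating ⟨ξ, f⟩ = 0 gives ⟨dξ, f⟩ = -⟨ξ, df⟩ = 0, so the flat derivative of ξ is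
    -- already its covariant derivative.
    have h := pairing_deriv_eq_zero (hermitianExt _ s) (hd F.normal_smooth) (hd F.smooth) (c := 0)
      (Eventually.of_forall fun z => by
        rw [chartExpr_apply, chartExpr_apply, hermitianExt_complexify, F.normal_tangent,
          Complex.ofReal_zero]) v
    rw [hξ', hf y hy, chartExpr_apply, chartExpr_apply, hermitianExt_complexify,
      hermitianExt_complexify, pseudoInner_comm _ _ (F.normal _), F.pseudoInner_tangentMap_normal,
      Complex.ofReal_zero, add_zero, Complex.ofReal_eq_zero] at h
    rw [hξ', ← map_neg, F.tangentMap_shapeOperator, neg_neg, F.covDerivNormal_apply, h, zero_smul,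
      sub_zero]
  have hDsurj : ∀ y ∈ φ.target, ∀ w, ∃ v, D y v = w := fun y hy w =>
    ⟨(D y).inverse w, (hDinv y hy).self_apply_inverse w⟩
  -- The shape operator in chart coordinates. Off the chart target `inverse` may take its default
  -- value 0, but A is used only on the target.
  let A : EuclideanSpace ℝ (Fin n) → EuclideanSpace ℝ (Fin n) →L[ℝ] EuclideanSpace ℝ (Fin n) :=
    fun y => LinearMap.toContinuousLinearMap
      ((D y).inverse.toLinearMap ∘ₗ F.shapeOperator (φ.symm y) ∘ₗ (D y).toLinearMap)
  have hDA : ∀ y ∈ φ.target, ∀ v, D y (A y v) = F.shapeOperator (φ.symm y) (D y v) :=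
    fun y hy v => (hDinv y hy).self_apply_inverse _
  refine norm_eq_one_of_local (hermitianExt _ s) (hermitianExt_smul_left _ s)
    (hermitianExt_conj _ s) (isOpen_extChartAt_target x₀) hu (contDiffOn_chartExpr F.smooth x₀)
    (contDiffOn_chartExpr F.normal_smooth x₀) ?_ ?_ ?_ ?_ ?_ ?_ ?_ ?_ ?_ (A := A) him ?_ ?_
  · rw [chartExpr_apply, hermitianExt_complexify, F.pseudoInner_toFun, Complex.ofReal_one]
  · rw [chartExpr_apply, hermitianExt_complexify]
    exact_mod_cast F.normal_unit _
  · intro y _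
    rw [chartExpr_apply, chartExpr_apply, hermitianExt_complexify, F.normal_tangent,
      Complex.ofReal_zero]
  · intro y hy v
    rw [hf y hy, chartExpr_apply, hermitianExt_complexify, F.pseudoInner_tangentMap_toFun,
      Complex.ofReal_zero]
  · intro y hy v
    rw [hf y hy, chartExpr_apply, hermitianExt_complexify, F.pseudoInner_tangentMap_normal,
      Complex.ofReal_zero]
  · intro y hy v w
    rw [hf y hy, hf y hy, hermitianExt_complexify, hermitianExt_complexify, pseudoInner_comm]
  · intro y hy v w hvw
    rw [hf y hy, hf y hy] at hvw
    exact (hDinv y hy).injective (F.immersion _ (complexify_injective _ hvw))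
  · intro w h1 h2
    -- Position and normal are real vectors, so the real and imaginary parts of w are orthogonal to
    -- them separately and each is tangent.
    obtain ⟨a, b, rfl⟩ := exists_eq_complexify_add _ w
    have hsplit : ∀ p, hermitianExt _ s (complexify _ a + Complex.I • complexify _ b)
        (complexify _ p) = (pseudoInner _ s a p : ℂ) + Complex.I * pseudoInner _ s b p := by
      intro p
      rw [map_add, add_apply, hermitianExt_smul_left, hermitianExt_complexify,
        hermitianExt_complexify]
    rw [chartExpr_apply, hsplit] at h1 h2
    have hreim : ∀ r t : ℝ, (r : ℂ) + Complex.I * t = 0 → r = 0 ∧ t = 0 := by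
      intro r t h
      exact ⟨by simpa using congrArg Complex.re h, by simpa using congrArg Complex.im h⟩
    obtain ⟨a', ha⟩ := F.tangentMap_range (φ.symm u) a (hreim _ _ h1).1 (hreim _ _ h2).1
    obtain ⟨b', hb⟩ := F.tangentMap_range (φ.symm u) b (hreim _ _ h1).2 (hreim _ _ h2).2
    obtain ⟨a'', rfl⟩ := hDsurj u hu a'
    obtain ⟨b'', rfl⟩ := hDsurj u hu b'
    exact ⟨a'', b'', by rw [hf u hu, hf u hu, ha, hb]⟩
  · intro v hv
    have h0 : D u v = 0 := by
      refine F.eq_zero_of_metric_eq_zero _ _ fun w => ?_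
      obtain ⟨z, rfl⟩ := hDsurj u hu w
      have h := hv z
      rw [hf u hu, hf u hu, hermitianExt_complexify] at h
      exact_mod_cast h
    exact (hDinv u hu).injective (h0.trans (map_zero (D u)).symm)
  · intro y hy v
    rw [hξ y hy, hf y hy, hDA y hy]
  · intro y hy v
    apply (hDinv y hy).injective
    rw [map_sub, map_smul, map_smul, hDA y hy, hDA y hy]
    exact hA2 _ _

end Hypersurface

end PseudoSphere

end

open PseudoSphere in
theorem corollary4p8 {M : Type*} [TopologicalSpace M]
    [ChartedSpace (EuclideanSpace ℝ (Fin 4)) M] [IsManifold (𝓡 4) ∞ M] [ConnectedSpace M]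
    (F : Hypersurface 4 3 M) (hiso : F.IsIsoparametric) (htype : F.IsTypeII)
    (hmult : ∀ x : M, ∀ lam ∈ F.principalCurvatures x, lam.im ≠ 0 →
      (F.principalCurvatures x).count lam = 2) :
    ∀ x : M, ∀ lam ∈ F.principalCurvatures x, lam.im ≠ 0 → ‖lam‖ = 1 := by
  intro x₀ lam hmem him
  have hA2 : ∀ (x : M) (v : TangentSpace (𝓡 4) x), F.shapeOperator x (F.shapeOperator x v) =
      (2 * lam.re) • F.shapeOperator x v - Complex.normSq lam • v := by
    intro x v
    refine (htype x).apply_apply him ?_ v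
    have h := hmult x₀ lam hmem him
    rw [hiso x₀ x] at h
    exact h
  exact F.norm_eq_one_of_shapeOperator x₀ him hA2
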